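/- Let $T=(t_s)_{s\in\mathbb{Z}}$ be i.i.d. random variables, uniformly distributed on $[0,1]$, and let $\mathbb{P}$ be their law, the product measure on $[0,1]^{\mathbb{Z}}$. In random sequential adsorption with nearest-neighbor exclusion on $\mathbb{Z}$, all sites start vacant and a particle is deposited at site $s$ at time $t_s$ if the sites $s-1$ and $s+1$ are both vacant at that time. That is, the states $\omega_s(t)\in\{0,1\}$ ($1$ for occupied, $0$ for vacant; $s\in\mathbb{Z}$, $t\in[0,1]$) satisfy $$\omega_s(t)=\mathbf 1\{t_s\le t\}\,\mathbf 1\{\omega_{s-1}(t_s)=0\}\,\mathbf 1\{\omega_{s+1}(t_s)=0\}\qquad (s\in\mathbb{Z},\ t\in[0,1]).$$ For $\mathbb{P}$-almost every $T$ this system has exactly one solution $(\omega_s(t))_{s\in\mathbb{Z},\,t\in[0,1]}$, and each $\omega_s(t)$ is a random variable. The pair correlation $C_s(t)=\mathbb{E}[\omega_0(t)\omega_s(t)]-\mathbb{E}[\omega_0(t)]\,\mathbb{E}[\omega_s(t)]$ satisfies, for all $t\in[0,1]$ and all $s\in\mathbb{Z}$, $$C_s(t)=-\tfrac12\,e^{-2t}\sum_{n=0}^{\infty}\frac{(-2t)^{2n+|s|+1}}{(2n+|s|+1)!},$$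 where the series converges absolutely. -/

import Mathlib

namespace RSA

open MeasureTheory

/-- The law of an i.i.d. family of arrival times `(t_s)_{s ∈ ℤ}`, each uniform on `[0,1]`:
the product of the Lebesgue measures on `[0,1]`. -/
noncomputable def timesLaw : Measure (ℤ → unitInterval) :=
  Measure.infinitePi (fun _ : ℤ => (volume : Measure unitInterval))

/-- `η` is an evolution of random sequential adsorption with nearest-neighbour exclusion on `ℤ`
driven by the arrival times `T`; here `η s t` is the state of the site `s` at time `t`
(`1` if occupied, `0` if vacant). It is the product of the indicators of `T s ≤ t`, of
"`s - 1` is vacant at time `T s`" and of "`s + 1` is vacant at time `T s`". -/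
def IsEvolution (T : ℤ → unitInterval) (η : ℤ → unitInterval → ℝ) : Prop :=
  ∀ (s : ℤ) (t : unitInterval),
    η s t = (if T s ≤ t then 1 else 0) *
      (if η (s - 1) (T s) = 0 then 1 else 0) *
      (if η (s + 1) (T s) = 0 then 1 else 0)

open Classical in
/-- The state `ω_s(T, t)`: the value of the unique evolution driven by `T`
(and `0` for those `T` that do not determine a unique evolution). -/
noncomputable def state (s : ℤ) (t : unitInterval) (T : ℤ → unitInterval) : ℝ :=
  if h : ∃! η : ℤ → unitInterval → ℝ, IsEvolution T η then h.choose s t else 0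

/-- `Cov_t(i, j) = E[ω_i(t) ω_j(t)] - E[ω_i(t)] E[ω_j(t)]`. -/
noncomputable def covAt (t : unitInterval) (i j : ℤ) : ℝ :=
  (∫ T, state i t T * state j t T ∂timesLaw) -
    (∫ T, state i t T ∂timesLaw) * (∫ T, state j t T ∂timesLaw)

/-- The pair correlation `C_s(t) = Cov_t(0, s)`. -/
noncomputable def pairCorrelation (s : ℤ) (t : unitInterval) : ℝ := covAt t 0 s

end RSA

/-! Until a particle arrives, the two sides of its site do not interact. Hence it is accepted if and
only if each neighbour is vacant at its arrival in the process on the half-line starting at that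
neighbour. This one-sided vacancy depends only on the decreasing run of arrival times leading away
from the site, and almost surely no such run is infinite, so the evolution exists and is unique.

One-sided vacancy satisfies a recursion along its half-line, so integrating out the arrival times
one after the other produces the partial sums of the exponential series: a particle arriving at time
`u` finds a given neighbour vacant with probability `exp (-u)`, which gives the one-site density.
For two sites, let `u` be the arrival time of the later of the two. The half-lines beyond the pair
contribute two independent exponential factors, and the segment between them contributes a
probability that satisfies a recursion in the length of the segment. The sites at distance `s`
are then both occupied at time `t` with probability
`∫ u in 0..t, exp (-2 * u) * (1 - ∑ k < s, (-2 * u) ^ k / k !)`. -/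

namespace RSA

open MeasureTheory Filter Set
open scoped Topology

section Combinatorics

variable {X : Type*} [LinearOrder X]

/-- In the process restricted to the sites `1, …, n` with arrival times `a 1, …, a n`, the
indicator that the site `1` is vacant at time `a 0`. A particle arriving at `1` before time `a 0`
is rejected exactly if `2` is occupied at its arrival, whence the recursion. -/
noncomputable def vacancyUpTo : ℕ → (ℕ → X) → ℝ
  | 0, _ => 1
  | n + 1, a => 1 - if a 1 < a 0 then vacancyUpTo n (fun k => a (k + 1)) else 0

theorem vacancyUpTo_zero (a : ℕ → X) : vacancyUpTo 0 a = 1 := rfl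

theorem vacancyUpTo_succ (n : ℕ) (a : ℕ → X) :
    vacancyUpTo (n + 1) a =
      1 - if a 1 < a 0 then vacancyUpTo n (fun k => a (k + 1)) else 0 := rfl

theorem vacancyUpTo_eq_zero_or_one (n : ℕ) (a : ℕ → X) :
    vacancyUpTo n a = 0 ∨ vacancyUpTo n a = 1 := by
  induction n generalizing a with
  | zero => exact Or.inr rfl
  | succ n ih =>
    rw [vacancyUpTo_succ]
    rcases ih fun k => a (k + 1) with h | h <;> split_ifs <;> simp [h]

theorem vacancyUpTo_eq_of_not_lt {k n : ℕ} {a : ℕ → X} (h : ¬ a (k + 1) < a k) (hn : k ≤ n) :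
    vacancyUpTo n a = vacancyUpTo k a := by
  induction k generalizing a n with
  | zero =>
    cases n with
    | zero => rfl
    | succ n => rw [vacancyUpTo_succ, if_neg h, sub_zero, vacancyUpTo_zero]
  | succ k ih =>
    obtain ⟨n, rfl⟩ : ∃ m, n = m + 1 := ⟨n - 1, by omega⟩
    rw [vacancyUpTo_succ, vacancyUpTo_succ, ih (a := fun k => a (k + 1)) h (by omega : k ≤ n)]

theorem vacancyUpTo_congr {n : ℕ} {a b : ℕ → X}
    (h : ∀ k ≤ n, a k = b k) : vacancyUpTo n a = vacancyUpTo n b := by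
  induction n generalizing a b with
  | zero => rfl
  | succ n ih =>
    rw [vacancyUpTo_succ, vacancyUpTo_succ, h 0 (by omega), h 1 (by omega),
      ih (a := fun k => a (k + 1)) fun k hk => h (k + 1) (by omega)]

theorem vacancyUpTo_mul_vacancyUpTo_reverse_succ (n : ℕ) (a : ℕ → X) :
    vacancyUpTo (n + 1) a * vacancyUpTo (n + 1) (fun k => a (n + 1 - k)) =
      vacancyUpTo (n + 1) a - (if a n < a (n + 1) then 1 else 0) *
        (vacancyUpTo n a * vacancyUpTo n fun k => a (n - k)) := by
  rw [vacancyUpTo_succ n fun k => a (n + 1 - k)]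
  simp only [Nat.add_sub_add_right, Nat.add_sub_cancel, Nat.sub_zero]
  split_ifs with h
  · rw [vacancyUpTo_eq_of_not_lt h.not_gt n.le_succ]
    ring
  · ring

open Classical in
/-- In the process on the sites `1, 2, …` with arrival times `a 1, a 2, …`, the indicator that the
site `1` is vacant at time `a 0`. If `a` is strictly decreasing, `vacancyUpTo n a` does not
converge, and the value is `0`. -/
noncomputable def vacancy (a : ℕ → X) : ℝ :=
  if ∀ᶠ n in atTop, vacancyUpTo n a = 1 then 1 else 0

theorem vacancy_eq_zero_or_one (a : ℕ → X) : vacancy a = 0 ∨ vacancy a = 1 := by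
  rw [vacancy]
  split_ifs <;> simp

theorem vacancy_eq_vacancyUpTo {k : ℕ} {a : ℕ → X} (h : ¬ a (k + 1) < a k) :
    vacancy a = vacancyUpTo k a := by
  have hlim : ∀ᶠ n in atTop, vacancyUpTo n a = vacancyUpTo k a :=
    (eventually_ge_atTop k).mono fun n hn => vacancyUpTo_eq_of_not_lt h hn
  rcases vacancyUpTo_eq_zero_or_one k a with h0 | h1
  · rw [h0] at hlim ⊢
    refine if_neg fun h1 => ?_
    obtain ⟨n, hn0, hn1⟩ := (hlim.and h1).exists
    exact zero_ne_one (hn0.symm.trans hn1)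
  · rw [h1] at hlim ⊢
    exact if_pos hlim

theorem vacancy_eq_one_sub {a : ℕ → X} (h : ∃ k, ¬ a (k + 1) < a k) :
    vacancy a = 1 - if a 1 < a 0 then vacancy (fun k => a (k + 1)) else 0 := by
  obtain ⟨k, hk⟩ := h
  cases k with
  | zero => rw [vacancy_eq_vacancyUpTo hk, vacancyUpTo_zero, if_neg hk, sub_zero]
  | succ k =>
    rw [vacancy_eq_vacancyUpTo hk, vacancyUpTo_succ,
      vacancy_eq_vacancyUpTo (a := fun k => a (k + 1)) hk]

theorem tendsto_vacancyUpTo {a : ℕ → X} (h : ∃ k, ¬ a (k + 1) < a k) :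
    Tendsto (fun n => vacancyUpTo n a) atTop (𝓝 (vacancy a)) := by
  obtain ⟨k, hk⟩ := h
  refine tendsto_const_nhds.congr' ((eventually_ge_atTop k).mono fun n hn => ?_)
  exact (vacancy_eq_vacancyUpTo hk).trans (vacancyUpTo_eq_of_not_lt hk hn).symm

/-- Screening: if the site `n + 1` is vacant when the particle at `n` arrives, then the sites beyond
`n` do not influence the site `1`. -/
theorem vacancy_mul_vacancy_add {n : ℕ} {a : ℕ → X} (h : ∃ k, ¬ a (k + 1 + n) < a (k + n)) :
    vacancy a * vacancy (fun k => a (k + n)) = vacancyUpTo n a * vacancy fun k => a (k + n) := by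
  induction n generalizing a with
  | zero => rcases vacancy_eq_zero_or_one a with ha | ha <;> simp [vacancyUpTo_zero, ha]
  | succ n ih =>
    have htail := ih (a := fun k => a (k + 1)) h
    have hdesc : ∃ k, ¬ a (k + 1) < a k := by
      obtain ⟨k, hk⟩ := h
      exact ⟨k + (n + 1), by rwa [add_right_comm]⟩
    rw [vacancy_eq_one_sub hdesc, vacancyUpTo_succ]
    split_ifs
    · linear_combination -htail
    · rfl

end Combinatorics

section Evolution

variable {X : Type*}

/-- The arrival times read from the site `s` in the direction `ε = ±1`. -/
def ray (ε : ℤˣ) (s : ℤ) (T : ℤ → X) (k : ℕ) : X := T (s + ε * k)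

theorem ray_zero (ε : ℤˣ) (s : ℤ) (T : ℤ → X) : ray ε s T 0 = T s := by simp [ray]

theorem ray_add (ε : ℤˣ) (s : ℤ) (T : ℤ → X) (k n : ℕ) :
    ray ε s T (k + n) = ray ε (s + ε * n) T k := by
  simp only [ray]
  congr 1
  push_cast
  ring

theorem ray_succ (ε : ℤˣ) (s : ℤ) (T : ℤ → X) (k : ℕ) :
    ray ε s T (k + 1) = ray ε (s + ε) T k := by
  rw [ray_add, Nat.cast_one, mul_one]

/-- The arrival times of neighbouring sites are distinct, and there is no infinite descending chain
of arrival times of consecutive sites, in either direction. -/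
def Generic [LinearOrder X] (T : ℤ → X) : Prop :=
  ∀ (ε : ℤˣ) (s : ℤ), T s ≠ T (s + ε) ∧ ∃ k, ¬ ray ε s T (k + 1) < ray ε s T k

theorem Generic.vacancy_ray [LinearOrder X] {T : ℤ → X} (hT : Generic T) (ε : ℤˣ) (s : ℤ) :
    vacancy (ray ε s T) = 1 - if T (s + ε) < T s then vacancy (ray ε (s + ε) T) else 0 := by
  rw [vacancy_eq_one_sub (hT ε s).2]
  simp only [ray_succ, ray_zero]

theorem IsEvolution.apply_eq {T : ℤ → unitInterval} {η : ℤ → unitInterval → ℝ}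
    (hη : IsEvolution T η) (ε : ℤˣ) (s : ℤ) (t : unitInterval) :
    η s t = (if T s ≤ t then 1 else 0) * (if η (s + ε) (T s) = 0 then 1 else 0) *
      (if η (s + (-ε : ℤˣ)) (T s) = 0 then 1 else 0) := by
  rw [hη s t]
  rcases Int.units_eq_one_or ε with rfl | rfl
  · simp only [Units.val_one, Units.val_neg, ← sub_eq_add_neg]
    ring
  · simp only [Units.val_one, Units.val_neg, neg_neg, ← sub_eq_add_neg]

theorem IsEvolution.ite_eq_vacancy {T : ℤ → unitInterval} {η : ℤ → unitInterval → ℝ}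
    (hη : IsEvolution T η) (hT : Generic T) (ε : ℤˣ) (s : ℤ) :
    (if η (s + ε) (T s) = 0 then (1 : ℝ) else 0) = vacancy (ray ε s T) := by
  obtain ⟨k, hk⟩ := (hT ε s).2
  induction k generalizing s with
  | zero =>
    rw [ray_succ, ray_zero, ray_zero] at hk
    have hle : ¬ T (s + ε) ≤ T s := fun h => hk (lt_of_le_of_ne h (hT ε s).1.symm)
    rw [hT.vacancy_ray, hη (s + ε)]
    simp [hk, hle]
  | succ k ih =>
    rw [hT.vacancy_ray, hη.apply_eq ε (s + ε)]
    by_cases h : T (s + ε) < T s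
    · have hback : η s (T (s + ε)) = 0 := by
        rw [hη s]
        simp [not_le.2 h]
      have hnext := ih (s + ε) (by rwa [← ray_succ, ← ray_succ])
      rcases vacancy_eq_zero_or_one (ray ε (s + ε) T) with h1 | h1 <;>
        simp [hnext, h1, hback, h, h.le]
    · have hle : ¬ T (s + ε) ≤ T s := fun hle => h (lt_of_le_of_ne hle (hT ε s).1.symm)
      simp [h, hle]

/-- The evolution driven by generic arrival times: a particle is accepted if and only if both
neighbouring sites are vacant in the processes on the half-lines to their left and right. -/
noncomputable def evolution (T : ℤ → unitInterval) (s : ℤ) (t : unitInterval) : ℝ :=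
  (if T s ≤ t then 1 else 0) * vacancy (ray (-1) s T) * vacancy (ray 1 s T)

theorem evolution_eq (ε : ℤˣ) (T : ℤ → unitInterval) (s : ℤ) (t : unitInterval) :
    evolution T s t =
      (if T s ≤ t then 1 else 0) * vacancy (ray (-ε) s T) * vacancy (ray ε s T) := by
  rcases Int.units_eq_one_or ε with rfl | rfl
  · rfl
  · rw [evolution, neg_neg]
    ring

theorem Generic.ite_evolution_eq_vacancy {T : ℤ → unitInterval} (hT : Generic T) (ε : ℤˣ)
    (s : ℤ) : (if evolution T (s + ε) (T s) = 0 then (1 : ℝ) else 0) = vacancy (ray ε s T) := by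
  have hback := hT.vacancy_ray (-ε) (s + ε)
  rw [Units.val_neg, add_neg_cancel_right] at hback
  rw [evolution_eq ε, hT.vacancy_ray ε s, hback]
  rcases lt_or_gt_of_ne (hT ε s).1 with h | h
  · simp [not_le.2 h, not_lt.2 h.le]
  · rcases vacancy_eq_zero_or_one (ray ε (s + ε) T) with h1 | h1 <;>
      simp [h, h.le, not_lt.2 h.le, h1]

theorem Generic.isEvolution_iff {T : ℤ → unitInterval} (hT : Generic T)
    {η : ℤ → unitInterval → ℝ} : IsEvolution T η ↔ η = evolution T := by
  constructor
  · intro hη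
    funext s t
    rw [hη.apply_eq (-1), hη.ite_eq_vacancy hT, neg_neg, hη.ite_eq_vacancy hT, evolution]
  · rintro rfl s t
    have hleft := hT.ite_evolution_eq_vacancy (-1) s
    rw [Units.val_neg, Units.val_one, ← sub_eq_add_neg] at hleft
    have hright := hT.ite_evolution_eq_vacancy 1 s
    rw [Units.val_one] at hright
    rw [hleft, hright, evolution]

theorem Generic.existsUnique_isEvolution {T : ℤ → unitInterval} (hT : Generic T) :
    ∃! η : ℤ → unitInterval → ℝ, IsEvolution T η :=
  ⟨evolution T, hT.isEvolution_iff.2 rfl, fun _ => hT.isEvolution_iff.1⟩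

theorem Generic.state_eq {T : ℤ → unitInterval} (hT : Generic T) (s : ℤ) (t : unitInterval) :
    state s t T = evolution T s t := by
  have h := hT.existsUnique_isEvolution
  rw [state, dif_pos h, hT.isEvolution_iff.1 h.choose_spec.1]

end Evolution

section InfiniteProduct

variable {ι : Type*} {X : ι → Type*} [∀ i, MeasurableSpace (X i)]

variable (μ : ∀ i, Measure (X i)) [∀ i, IsProbabilityMeasure (μ i)]

theorem measurePreserving_update [DecidableEq ι] (j : ι) :
    MeasurePreserving (fun q : (∀ i, X i) × X j => Function.update q.1 j q.2)
      ((Measure.infinitePi μ).prod (μ j)) (Measure.infinitePi μ) := by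
  refine ⟨measurable_update', Measure.eq_infinitePi μ fun s t ht => ?_⟩
  have hbox : ∀ s : Finset ι, Measure.infinitePi μ (Set.pi s t) = ∏ i ∈ s, μ i (t i) :=
    fun s => Measure.infinitePi_pi μ fun i _ => ht i
  rw [Measure.map_apply measurable_update'
    (MeasurableSet.pi s.countable_toSet fun i _ => ht i)]
  by_cases hj : j ∈ s
  · have hpre : (fun q : (∀ i, X i) × X j => Function.update q.1 j q.2) ⁻¹' Set.pi s t =
        Set.pi (s.erase j : Finset ι) t ×ˢ t j := by
      ext q
      rw [mem_preimage, update_mem_pi_iff]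
      simp [hj, and_comm]
    rw [hpre, Measure.prod_prod, hbox, Finset.prod_erase_mul _ _ hj]
  · have hpre : (fun q : (∀ i, X i) × X j => Function.update q.1 j q.2) ⁻¹' Set.pi s t =
        Set.pi (s : Set ι) t ×ˢ univ := by
      ext q
      rw [mem_preimage, update_mem_pi_iff]
      simp [hj]
    rw [hpre, Measure.prod_prod, hbox, measure_univ, mul_one]

theorem integral_eq_integral_integral_update [DecidableEq ι] {F : (∀ i, X i) → ℝ}
    (hF : Integrable F (Measure.infinitePi μ)) (j : ι) :
    ∫ T, F T ∂Measure.infinitePi μ =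
      ∫ T, (∫ x, F (Function.update T j x) ∂μ j) ∂Measure.infinitePi μ := by
  have h := measurePreserving_update μ j
  rw [← integral_prod (fun q : (∀ i, X i) × X j => F (Function.update q.1 j q.2))
    (h.integrable_comp_of_integrable hF)]
  conv_lhs => rw [← h.map_eq]
  refine integral_map h.measurable.aemeasurable ?_
  rw [h.map_eq]
  exact hF.aestronglyMeasurable

end InfiniteProduct

section IID

variable {ι X : Type*} [MeasurableSpace X] (μ : Measure X) [IsProbabilityMeasure μ]

theorem ae_infinitePi_apply_ne [MeasurableEq X] [NullSingletonClass μ] {i j : ι} (hij : i ≠ j) :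
    ∀ᵐ T ∂Measure.infinitePi fun _ : ι => μ, T i ≠ T j := by
  have hdiag : MeasurableSet {q : X × X | q.1 ≠ q.2} :=
    (measurableSet_eq_fun measurable_fst measurable_snd).compl
  have hpair : Measurable fun T : ι → X => (T i, T j) := by fun_prop
  suffices h : ∀ᵐ q ∂(Measure.infinitePi fun _ : ι => μ).map (fun T => (T i, T j)), q.1 ≠ q.2 from
    (ae_map_iff hpair.aemeasurable hdiag).1 h
  rw [Measure.infinitePi_map_eval_prod hij, Measure.ae_prod_iff_ae_ae hdiag]
  exact .of_forall fun x => (measure_eq_zero_iff_ae_notMem.1 (measure_singleton x)).mono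
    fun y hy => Ne.symm hy

theorem ae_infinitePi_exists_notMem {A : Set X} (hA : MeasurableSet A) (hμA : μ A < 1) {s : Set ι}
    (hs : s.Infinite) : ∀ᵐ T ∂Measure.infinitePi fun _ : ι => μ, ∃ i ∈ s, T i ∉ A := by
  have hle : ∀ n : ℕ, (Measure.infinitePi fun _ : ι => μ) {T | ∀ i ∈ s, T i ∈ A} ≤ μ A ^ n := by
    intro n
    obtain ⟨F, hFs, rfl⟩ := hs.exists_subset_card_eq n
    calc _ ≤ (Measure.infinitePi fun _ : ι => μ) (Set.pi F fun _ => A) :=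
          measure_mono fun T (hT : ∀ i ∈ s, T i ∈ A) i hi => hT i (hFs hi)
      _ = μ A ^ F.card := by
          rw [Measure.infinitePi_pi _ fun _ _ => hA, Finset.prod_const]
  have hzero := le_antisymm
    (ge_of_tendsto' (ENNReal.tendsto_pow_atTop_nhds_zero_of_lt_one hμA) hle) zero_le
  filter_upwards [measure_eq_zero_iff_ae_notMem.1 hzero] with T hT
  simpa using hT

end IID

section BoundedObservables

variable {ι X : Type*} [MeasurableSpace X]

/-- Bounded random variables on a product space that depend only on the coordinates in `s`: the
integrands that survive when the other coordinates are integrated out. -/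
structure IsBddMeasurableOn (F : (ι → X) → ℝ) (s : Set ι) : Prop where
  measurable : Measurable F
  bounded : ∃ C, ∀ T, |F T| ≤ C
  dependsOn : DependsOn F s

namespace IsBddMeasurableOn

variable {F G : (ι → X) → ℝ} {s t : Set ι}

theorem mono (hF : IsBddMeasurableOn F s) (hst : s ⊆ t) : IsBddMeasurableOn F t :=
  ⟨hF.measurable, hF.bounded, hF.dependsOn.mono hst⟩

theorem mul (hF : IsBddMeasurableOn F s) (hG : IsBddMeasurableOn G s) :
    IsBddMeasurableOn (fun T => F T * G T) s := by
  obtain ⟨hFm, ⟨C, hC⟩, hFs⟩ := hF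
  obtain ⟨hGm, ⟨D, hD⟩, hGs⟩ := hG
  refine ⟨hFm.mul hGm, ⟨C * D, fun T => ?_⟩, fun T T' h => congrArg₂ (· * ·) (hFs h) (hGs h)⟩
  rw [abs_mul]
  exact mul_le_mul (hC T) (hD T) (abs_nonneg _) ((abs_nonneg _).trans (hC T))

theorem integrable (hF : IsBddMeasurableOn F s) (ν : Measure (ι → X)) [IsFiniteMeasure ν] :
    Integrable F ν := by
  obtain ⟨C, hC⟩ := hF.bounded
  exact Integrable.of_bound hF.measurable.aestronglyMeasurable C (.of_forall hC)

theorem apply_update [DecidableEq ι] {j : ι} (hF : IsBddMeasurableOn F {j}ᶜ) (T : ι → X) (x : X) :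
    F (Function.update T j x) = F T :=
  hF.dependsOn fun _ hi => Function.update_of_ne hi _ _

end IsBddMeasurableOn

theorem isBddMeasurableOn_of_eq_zero_or_one {F : (ι → X) → ℝ} {s : Set ι} (hF : Measurable F)
    (h01 : ∀ T, F T = 0 ∨ F T = 1) (hs : DependsOn F s) : IsBddMeasurableOn F s :=
  ⟨hF, ⟨1, fun T => by rcases h01 T with h | h <;> simp [h]⟩, hs⟩

theorem isBddMeasurableOn_one (s : Set ι) : IsBddMeasurableOn (fun _ : ι → X => 1) s :=
  isBddMeasurableOn_of_eq_zero_or_one measurable_const (fun _ => .inr rfl) fun _ _ _ => rfl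

end BoundedObservables

section OrderedCoordinates

variable {ι X : Type*} [LinearOrder X] [TopologicalSpace X] [OrderClosedTopology X]
  [SecondCountableTopology X] [MeasurableSpace X] [OpensMeasurableSpace X]

theorem isBddMeasurableOn_le (i : ι) (t : X) :
    IsBddMeasurableOn (fun T : ι → X => if T i ≤ t then 1 else 0) {i} := by
  refine isBddMeasurableOn_of_eq_zero_or_one ?_ (fun T => ?_) fun T T' h => ?_
  · exact Measurable.ite (measurableSet_le (measurable_pi_apply i) measurable_const)
      measurable_const measurable_const
  · split_ifs <;> simp
  · simp only [h i rfl]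

theorem isBddMeasurableOn_lt {i j : ι} {s : Set ι} (hi : i ∈ s) (hj : j ∈ s) :
    IsBddMeasurableOn (fun T : ι → X => if T i < T j then 1 else 0) s := by
  refine isBddMeasurableOn_of_eq_zero_or_one ?_ (fun T => ?_) fun T T' h => ?_
  · exact Measurable.ite (measurableSet_lt (measurable_pi_apply i) (measurable_pi_apply j))
      measurable_const measurable_const
  · split_ifs <;> simp
  · simp only [h i hi, h j hj]

theorem measurable_vacancyUpTo (n : ℕ) : Measurable (vacancyUpTo (X := X) n) := by
  induction n with
  | zero => exact measurable_const
  | succ n ih =>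
    refine measurable_const.sub (Measurable.ite ?_ ?_ measurable_const)
    · exact measurableSet_lt (measurable_pi_apply 1) (measurable_pi_apply 0)
    · exact ih.comp (measurable_pi_lambda _ fun k => measurable_pi_apply (k + 1))

theorem measurable_vacancy : Measurable (vacancy (X := X)) := by
  refine Measurable.ite ?_ measurable_const measurable_const
  simp only [Filter.eventually_atTop]
  exact measurableSet_setOfPred.2 <| Measurable.exists fun m => Measurable.forall fun n =>
    measurable_const.imp <| measurableSet_setOfPred.1 <|
      measurable_vacancyUpTo n (measurableSet_singleton 1)

theorem isBddMeasurableOn_vacancyUpTo {n : ℕ} {σ : ℕ → ι} {s : Set ι} (hσ : ∀ k ≤ n, σ k ∈ s) :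
    IsBddMeasurableOn (fun T : ι → X => vacancyUpTo n fun k => T (σ k)) s :=
  isBddMeasurableOn_of_eq_zero_or_one
    ((measurable_vacancyUpTo n).comp (by fun_prop))
    (fun _ => vacancyUpTo_eq_zero_or_one _ _)
    fun _ _ h => vacancyUpTo_congr fun k hk => h (σ k) (hσ k hk)

theorem isBddMeasurableOn_vacancy {σ : ℕ → ι} {s : Set ι} (hσ : ∀ k, σ k ∈ s) :
    IsBddMeasurableOn (fun T : ι → X => vacancy fun k => T (σ k)) s :=
  isBddMeasurableOn_of_eq_zero_or_one
    (measurable_vacancy.comp (by fun_prop))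
    (fun _ => vacancy_eq_zero_or_one _)
    fun _ _ h => congrArg vacancy (funext fun k => h (σ k) (hσ k))

end OrderedCoordinates

section UniformTimes

variable {ι : Type*}

theorem isBddMeasurableOn_comp {f : ℝ → ℝ → ℝ} (hf : Measurable (Function.uncurry f)) {C : ℝ}
    (hC : ∀ x ∈ Icc (0 : ℝ) 1, ∀ y ∈ Icc (0 : ℝ) 1, |f x y| ≤ C) {i j : ι} {s : Set ι}
    (hi : i ∈ s) (hj : j ∈ s) :
    IsBddMeasurableOn (fun T : ι → unitInterval => f (T i) (T j)) s := by
  refine ⟨?_, ⟨C, fun T => hC _ (T i).2 _ (T j).2⟩, fun T T' h => by rw [h i hi, h j hj]⟩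
  exact hf.comp (by fun_prop : Measurable fun T : ι → unitInterval => ((T i : ℝ), (T j : ℝ)))

theorem integral_coe_unitInterval (f : ℝ → ℝ) :
    ∫ x : unitInterval, f x = ∫ x in (0 : ℝ)..1, f x := by
  rw [intervalIntegral.integral_of_le zero_le_one, ← integral_Icc_eq_integral_Ioc]
  exact integral_subtype_comap measurableSet_Icc f

theorem integral_ite_le_unitInterval (f : ℝ → ℝ) (u : unitInterval) :
    ∫ x : unitInterval, (if x ≤ u then f x else 0) = ∫ x in (0 : ℝ)..u, f x := by
  have h := integral_coe_unitInterval ((Iic (u : ℝ)).indicator f)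
  rw [intervalIntegral.integral_of_le zero_le_one, setIntegral_indicator measurableSet_Iic,
    Ioc_inter_Iic, min_eq_right u.2.2, ← intervalIntegral.integral_of_le u.2.1] at h
  exact h

theorem integral_ite_lt_unitInterval (f : ℝ → ℝ) (u : unitInterval) :
    ∫ x : unitInterval, (if x < u then f x else 0) = ∫ x in (0 : ℝ)..u, f x := by
  rw [← integral_ite_le_unitInterval]
  refine integral_congr_ae ?_
  filter_upwards [Measure.ae_ne volume u] with x hx
  simp only [lt_iff_le_and_ne, hx, ne_eq, not_false_eq_true, and_true]

/-- The law of an i.i.d. family of arrival times, uniform on `[0, 1]`, indexed by any type `ι`. -/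
noncomputable abbrev uniformLaw (ι : Type*) : Measure (ι → unitInterval) :=
  Measure.infinitePi fun _ => volume

theorem integral_ite_le_uniformLaw (i : ι) (t : unitInterval) {f : ℝ → ℝ} (hf : Measurable f) :
    ∫ T, (if T i ≤ t then f (T i) else 0) ∂uniformLaw ι = ∫ u in (0 : ℝ)..t, f u := by
  have heval := measurePreserving_eval_infinitePi (fun _ : ι => (volume : Measure unitInterval)) i
  have hm : Measurable fun x : unitInterval => if x ≤ t then f x else 0 :=
    Measurable.ite measurableSet_Iic (hf.comp measurable_subtype_coe) measurable_const
  rw [← integral_ite_le_unitInterval, ← heval.map_eq,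
    integral_map heval.measurable.aemeasurable hm.aestronglyMeasurable]

theorem integral_mul_ite_lt {H : (ι → unitInterval) → ℝ} {f : ℝ → ℝ → ℝ} {i j p : ι}
    (hi : i ≠ j) (hp : p ≠ j) (hH : IsBddMeasurableOn H {j}ᶜ)
    (hf : IsBddMeasurableOn (fun T : ι → unitInterval => f (T p) (T j)) univ) :
    ∫ T, H T * ((if T j < T i then 1 else 0) * f (T p) (T j)) ∂uniformLaw ι =
      ∫ T, H T * (∫ x in (0 : ℝ)..T i, f (T p) x) ∂uniformLaw ι := by
  classical
  have hint := (hH.mono (subset_univ _)).mul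
    ((isBddMeasurableOn_lt (mem_univ j) (mem_univ i)).mul hf)
  rw [integral_eq_integral_integral_update _ (hint.integrable _) j]
  refine integral_congr_ae (.of_forall fun T => ?_)
  simp only [hH.apply_update, Function.update_self, Function.update_of_ne hi,
    Function.update_of_ne hp, integral_const_mul, ite_mul, one_mul, zero_mul,
    integral_ite_lt_unitInterval]

theorem ae_exists_not_lt {σ : ℕ → ι} (hσ : Function.Injective σ) :
    ∀ᵐ T ∂uniformLaw ι, ∃ k, ¬ T (σ (k + 1)) < T (σ k) := by
  have hlarge : ∀ᵐ T ∂uniformLaw ι, ∀ n, TopologicalSpace.denseSeq unitInterval n < 1 →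
      ∃ i ∈ range fun k => σ (k + 1), T i ∉ Iic (TopologicalSpace.denseSeq unitInterval n) := by
    refine ae_all_iff.2 fun n => Filter.eventually_imp_distrib_left.2 fun hn => ?_
    refine ae_infinitePi_exists_notMem volume measurableSet_Iic ?_
      (infinite_range_of_injective (hσ.comp (add_left_injective 1)))
    rw [unitInterval.volume_Iic, ENNReal.ofReal_lt_one]
    exact hn
  filter_upwards [hlarge] with T hT
  by_contra! hdesc
  have hanti : StrictAnti fun k => T (σ k) := strictAnti_nat_of_succ_lt hdesc
  obtain ⟨_, ⟨n, rfl⟩, hlo, hhi⟩ :=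
    (TopologicalSpace.denseRange_denseSeq unitInterval).exists_between
      ((hdesc 0).trans_le unitInterval.le_one')
  obtain ⟨_, ⟨k, rfl⟩, hk⟩ := hT n hhi
  exact hk ((hanti.antitone (Nat.le_add_left 1 k)).trans hlo.le)

end UniformTimes

section ExponentialSums

/-- The sum of the first `n` terms of the series of `exp (-x)`. -/
noncomputable def expNegSum (n : ℕ) (x : ℝ) : ℝ :=
  ∑ k ∈ Finset.range n, (-x) ^ k / (k.factorial : ℝ)

theorem expNegSum_zero (x : ℝ) : expNegSum 0 x = 0 := rfl

theorem expNegSum_one (x : ℝ) : expNegSum 1 x = 1 := by simp [expNegSum]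

theorem expNegSum_succ (n : ℕ) (x : ℝ) :
    expNegSum (n + 1) x = expNegSum n x + (-x) ^ n / (n.factorial : ℝ) :=
  Finset.sum_range_succ _ n

theorem expNegSum_succ_zero (n : ℕ) : expNegSum (n + 1) 0 = 1 := by
  simp [expNegSum, Finset.sum_range_succ']

theorem continuous_expNegSum (n : ℕ) : Continuous (expNegSum n) := by
  unfold expNegSum
  fun_prop

theorem abs_expNegSum_le (n : ℕ) (x : ℝ) : |expNegSum n x| ≤ Real.exp |x| := by
  calc |expNegSum n x| ≤ ∑ k ∈ Finset.range n, |(-x) ^ k / (k.factorial : ℝ)| :=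
        Finset.abs_sum_le_sum_abs _ _
    _ = ∑ k ∈ Finset.range n, |x| ^ k / (k.factorial : ℝ) := by
        simp only [abs_div, abs_pow, abs_neg, Nat.abs_cast]
    _ ≤ Real.exp |x| := Real.sum_le_exp_of_nonneg (abs_nonneg x) n

theorem tendsto_expNegSum (x : ℝ) :
    Tendsto (fun n => expNegSum n x) atTop (𝓝 (Real.exp (-x))) := by
  have h := (NormedSpace.expSeries_div_hasSum_exp (-x)).tendsto_sum_nat
  rwa [← Real.exp_eq_exp_ℝ] at h

theorem hasDerivAt_expNegSum_succ (n : ℕ) (x : ℝ) :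
    HasDerivAt (expNegSum (n + 1)) (-expNegSum n x) x := by
  induction n with
  | zero =>
    rw [funext expNegSum_one, expNegSum_zero, neg_zero]
    exact hasDerivAt_const x 1
  | succ n ih =>
    have hterm : HasDerivAt (fun y : ℝ => (-y) ^ (n + 1) / ((n + 1).factorial : ℝ))
        (-((-x) ^ n / (n.factorial : ℝ))) x := by
      refine (((hasDerivAt_id x).neg.pow (n + 1)).div_const _).congr_deriv ?_
      rw [Nat.factorial_succ]
      push_cast
      simp only [id, Pi.neg_apply]
      field_simp
    rw [funext (expNegSum_succ (n + 1)), expNegSum_succ n, neg_add]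
    exact ih.add hterm

theorem integral_expNegSum (n : ℕ) (a b : ℝ) :
    ∫ x in a..b, expNegSum n x = expNegSum (n + 1) a - expNegSum (n + 1) b := by
  rw [intervalIntegral.integral_eq_sub_of_hasDerivAt (f := fun x => -expNegSum (n + 1) x)
    (fun x _ => by simpa using (hasDerivAt_expNegSum_succ n x).fun_neg)
    ((continuous_expNegSum n).intervalIntegrable _ _)]
  ring

/-- The conditional expectation of `vacancyUpTo (n + 1)` along a segment, given the arrival times
`w` and `v` at its far and near ends. -/
noncomputable def segmentVacancy (n : ℕ) (w v : ℝ) : ℝ :=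
  expNegSum (n + 1) v + if w < v then expNegSum n (v - w) - expNegSum (n + 1) (v - w) else 0

theorem segmentVacancy_zero (w v : ℝ) : segmentVacancy 0 w v = 1 - if w < v then 1 else 0 := by
  rw [segmentVacancy, expNegSum_one, expNegSum_one, expNegSum_zero]
  split_ifs <;> ring

theorem integral_ite_lt {f : ℝ → ℝ} {w v : ℝ} (hw : 0 ≤ w) (hv : 0 ≤ v) :
    ∫ x in (0 : ℝ)..v, (if w < x then f x else 0) = if w < v then ∫ x in w..v, f x else 0 := by
  have hind : (fun x => if w < x then f x else 0) = (Ioi w).indicator f := rfl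
  rw [hind, intervalIntegral.integral_of_le hv,
    setIntegral_indicator measurableSet_Ioi, Ioc_inter_Ioi, max_eq_right hw]
  split_ifs with h
  · rw [intervalIntegral.integral_of_le h.le]
  · rw [Ioc_eq_empty h, setIntegral_empty]

theorem segmentVacancy_succ (n : ℕ) {w v : ℝ} (hw : 0 ≤ w) (hv : 0 ≤ v) :
    segmentVacancy (n + 1) w v = 1 - ∫ x in (0 : ℝ)..v, segmentVacancy n w x := by
  have hint : ∀ k, IntervalIntegrable (fun x => expNegSum k (x - w)) volume w v :=
    fun k => ((continuous_expNegSum k).comp (by fun_prop)).intervalIntegrable _ _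
  have hjump : IntervalIntegrable
      (fun x => if w < x then expNegSum n (x - w) - expNegSum (n + 1) (x - w) else 0)
      volume 0 v := by
    have hc : Continuous fun x => expNegSum n (x - w) - expNegSum (n + 1) (x - w) :=
      ((continuous_expNegSum n).comp (by fun_prop)).sub
        ((continuous_expNegSum (n + 1)).comp (by fun_prop))
    have h := hc.intervalIntegrable (μ := volume) 0 v
    exact ⟨h.1.indicator measurableSet_Ioi, h.2.indicator measurableSet_Ioi⟩
  simp only [segmentVacancy]
  rw [intervalIntegral.integral_add ((continuous_expNegSum _).intervalIntegrable _ _) hjump,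
    integral_ite_lt hw hv, intervalIntegral.integral_sub (hint _) (hint _),
    intervalIntegral.integral_comp_sub_right (expNegSum n),
    intervalIntegral.integral_comp_sub_right (expNegSum (n + 1)), integral_expNegSum,
    integral_expNegSum, integral_expNegSum, sub_self, expNegSum_succ_zero, expNegSum_succ_zero]
  split_ifs <;> ring

theorem abs_segmentVacancy_le (n : ℕ) {w v : ℝ} (hw : w ∈ Icc (0 : ℝ) 1) (hv : v ∈ Icc (0 : ℝ) 1) :
    |segmentVacancy n w v| ≤ 3 * Real.exp 1 := by
  have hle : ∀ k x, |x| ≤ 1 → |expNegSum k x| ≤ Real.exp 1 := fun k x hx =>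
    (abs_expNegSum_le k x).trans (Real.exp_le_exp.2 hx)
  have hv1 : |v| ≤ 1 := abs_le.2 ⟨by linarith [hv.1], hv.2⟩
  have hvw : |v - w| ≤ 1 := abs_le.2 ⟨by linarith [hv.1, hw.2], by linarith [hv.2, hw.1]⟩
  have h := abs_le.1 (hle (n + 1) v hv1)
  have h₀ := abs_le.1 (hle n (v - w) hvw)
  have h₁ := abs_le.1 (hle (n + 1) (v - w) hvw)
  rw [segmentVacancy, abs_le]
  split_ifs <;> constructor <;> linarith [Real.exp_pos 1]

theorem tendsto_segmentVacancy {v C : ℝ} {w : ℕ → ℝ} (hw : ∀ n, |v - w n| ≤ C) :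
    Tendsto (fun n => segmentVacancy n (w n) v) atTop (𝓝 (Real.exp (-v))) := by
  have hsum := (tendsto_expNegSum v).comp (tendsto_add_atTop_nat 1)
  have hterm : ∀ n, ‖if w n < v then expNegSum n (v - w n) - expNegSum (n + 1) (v - w n) else 0‖ ≤
      C ^ n / (n.factorial : ℝ) := by
    intro n
    have hC : 0 ≤ C := (abs_nonneg _).trans (hw n)
    split_ifs
    · rw [expNegSum_succ, sub_add_cancel_left, norm_neg, Real.norm_eq_abs, abs_div, abs_pow,
        abs_neg, Nat.abs_cast]
      gcongr
      exact hw n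
    · rw [norm_zero]
      positivity
  have h := hsum.add (squeeze_zero_norm hterm (FloorSemiring.tendsto_pow_div_factorial_atTop C))
  rwa [add_zero] at h

theorem measurable_segmentVacancy (n : ℕ) : Measurable (Function.uncurry (segmentVacancy n)) := by
  have hE : ∀ k, Measurable (expNegSum k) := fun k => (continuous_expNegSum k).measurable
  refine ((hE _).comp measurable_snd).add (Measurable.ite ?_ ?_ measurable_const)
  · exact measurableSet_lt measurable_fst measurable_snd
  · exact ((hE _).comp (by fun_prop)).sub ((hE _).comp (by fun_prop))

/-- The conditional probability that both ends of an isolated segment of `n` sites and two ends get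
occupied, given the arrival times `u` and `v < u` of the ends. -/
noncomputable def segmentPair (n : ℕ) (u v : ℝ) : ℝ :=
  1 / 2 * (expNegSum n (u + v) + expNegSum (n + 1) (u + v) +
    (expNegSum n (u - v) - expNegSum (n + 1) (u - v)))

theorem continuous_segmentPair (n : ℕ) : Continuous (Function.uncurry (segmentPair n)) := by
  have hE : ∀ k, Continuous (expNegSum k) := continuous_expNegSum
  unfold segmentPair Function.uncurry
  fun_prop

theorem abs_segmentPair_le (n : ℕ) {u v : ℝ} (hu : u ∈ Icc (0 : ℝ) 1) (hv : v ∈ Icc (0 : ℝ) 1) :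
    |segmentPair n u v| ≤ 2 * Real.exp 2 := by
  have hle : ∀ k x, |x| ≤ 2 → |expNegSum k x| ≤ Real.exp 2 := fun k x hx =>
    (abs_expNegSum_le k x).trans (Real.exp_le_exp.2 hx)
  have hadd : |u + v| ≤ 2 := abs_le.2 ⟨by linarith [hu.1, hv.1], by linarith [hu.2, hv.2]⟩
  have hsub : |u - v| ≤ 2 := abs_le.2 ⟨by linarith [hu.1, hv.2], by linarith [hu.2, hv.1]⟩
  have h₀ := abs_le.1 (hle n (u + v) hadd)
  have h₁ := abs_le.1 (hle (n + 1) (u + v) hadd)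
  have h₂ := abs_le.1 (hle n (u - v) hsub)
  have h₃ := abs_le.1 (hle (n + 1) (u - v) hsub)
  rw [segmentPair, abs_le]
  constructor <;> linarith

theorem segmentPair_zero (u v : ℝ) : segmentPair 0 u v = 0 := by
  simp [segmentPair, expNegSum_zero, expNegSum_one]

theorem segmentPair_succ (n : ℕ) {u v : ℝ} (h : v < u) :
    segmentPair (n + 1) u v =
      segmentVacancy (n + 1) v u - ∫ x in (0 : ℝ)..v, segmentPair n u x := by
  have hadd : ∀ k, ∫ x in (0 : ℝ)..v, expNegSum k (u + x) =
      expNegSum (k + 1) u - expNegSum (k + 1) (u + v) := fun k => by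
    rw [intervalIntegral.integral_comp_add_left (expNegSum k), integral_expNegSum, add_zero]
  have hsub : ∀ k, ∫ x in (0 : ℝ)..v, expNegSum k (u - x) =
      expNegSum (k + 1) (u - v) - expNegSum (k + 1) u := fun k => by
    rw [intervalIntegral.integral_comp_sub_left (expNegSum k), integral_expNegSum, sub_zero]
  have hint : ∀ k, ∀ f : ℝ → ℝ, Continuous f →
      IntervalIntegrable (fun x => expNegSum k (f x)) volume 0 v :=
    fun k f hf => ((continuous_expNegSum k).comp hf).intervalIntegrable _ _
  have hint_add : ∀ k, IntervalIntegrable (fun x => expNegSum k (u + x)) volume 0 v :=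
    fun k => hint k _ (by fun_prop)
  have hint_sub : ∀ k, IntervalIntegrable (fun x => expNegSum k (u - x)) volume 0 v :=
    fun k => hint k _ (by fun_prop)
  simp only [segmentPair, segmentVacancy, if_pos h]
  rw [intervalIntegral.integral_const_mul, intervalIntegral.integral_add
    ((hint_add _).add (hint_add _)) ((hint_sub _).sub (hint_sub _)),
    intervalIntegral.integral_add (hint_add _) (hint_add _),
    intervalIntegral.integral_sub (hint_sub _) (hint_sub _), hadd, hadd, hsub, hsub]
  ring

theorem integral_exp_neg_mul_segmentPair (n : ℕ) (u : ℝ) :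
    ∫ v in (0 : ℝ)..u, Real.exp (-v) * segmentPair n u v =
      1 / 2 * (Real.exp (-u) * (1 - expNegSum (n + 1) (2 * u))) := by
  have hderiv : ∀ v, HasDerivAt
      (fun v => 1 / 2 * (Real.exp (-v) * (expNegSum (n + 1) (u - v) - expNegSum (n + 1) (u + v))))
      (Real.exp (-v) * segmentPair n u v) v := by
    intro v
    have hexp : HasDerivAt (fun v => Real.exp (-v)) (-Real.exp (-v)) v := by
      simpa using (hasDerivAt_id v).neg.exp
    have hsub := (hasDerivAt_expNegSum_succ n (u - v)).comp_const_sub u v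
    have hadd := (hasDerivAt_expNegSum_succ n (u + v)).comp_const_add u v
    refine ((hexp.mul (hsub.sub hadd)).const_mul (1 / 2)).congr_deriv ?_
    simp only [segmentPair, Pi.sub_apply]
    ring
  have hcont : Continuous fun v => Real.exp (-v) * segmentPair n u v :=
    (Real.continuous_exp.comp continuous_neg).mul
      ((continuous_segmentPair n).comp (by fun_prop : Continuous fun v : ℝ => (u, v)))
  rw [intervalIntegral.integral_eq_sub_of_hasDerivAt (fun v _ => hderiv v)
    (hcont.intervalIntegrable _ _), sub_self, expNegSum_succ_zero, sub_zero, add_zero, sub_self,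
    two_mul u]
  ring

theorem hasDerivAt_exp_neg_two_mul (u : ℝ) :
    HasDerivAt (fun u : ℝ => Real.exp (-2 * u)) (-2 * Real.exp (-2 * u)) u := by
  simpa [mul_comm] using ((hasDerivAt_id u).const_mul (-2)).exp

/-- The probability that two sites at distance `s` are both occupied at time `t`. -/
noncomputable def pairProb (s : ℕ) (t : ℝ) : ℝ :=
  ∫ u in (0 : ℝ)..t, Real.exp (-2 * u) * (1 - expNegSum s (2 * u))

theorem pairProb_zero (t : ℝ) : pairProb 0 t = (1 - Real.exp (-2 * t)) / 2 := by
  have hderiv : ∀ u, HasDerivAt (fun u => -(1 / 2) * Real.exp (-2 * u)) (Real.exp (-2 * u)) u :=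
    fun u => ((hasDerivAt_exp_neg_two_mul u).const_mul _).congr_deriv (by ring)
  have hcont : Continuous fun u : ℝ => Real.exp (-2 * u) := by fun_prop
  simp only [pairProb, expNegSum_zero, sub_zero, mul_one]
  rw [intervalIntegral.integral_eq_sub_of_hasDerivAt (fun u _ => hderiv u)
    (hcont.intervalIntegrable _ _), mul_zero, Real.exp_zero]
  ring

theorem pairProb_add_succ (s : ℕ) (t : ℝ) :
    pairProb s t + pairProb (s + 1) t =
      1 / 2 - Real.exp (-2 * t) + 1 / 2 * Real.exp (-2 * t) * expNegSum (s + 1) (2 * t) := by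
  have hint : ∀ s, IntervalIntegrable (fun u => Real.exp (-2 * u) * (1 - expNegSum s (2 * u)))
      volume 0 t := fun s =>
    (Continuous.mul (by fun_prop) (continuous_const.sub
      ((continuous_expNegSum s).comp (by fun_prop)))).intervalIntegrable _ _
  have hderiv : ∀ u, HasDerivAt
      (fun u => Real.exp (-2 * u) * (1 / 2 * expNegSum (s + 1) (2 * u) - 1))
      (Real.exp (-2 * u) * (1 - expNegSum s (2 * u)) +
        Real.exp (-2 * u) * (1 - expNegSum (s + 1) (2 * u))) u := by
    intro u
    have h := (hasDerivAt_expNegSum_succ s (2 * u)).comp u ((hasDerivAt_id u).const_mul 2)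
    refine ((hasDerivAt_exp_neg_two_mul u).mul ((h.const_mul (1 / 2)).sub_const 1)).congr_deriv ?_
    simp only [Function.comp_apply]
    ring
  rw [pairProb, pairProb, ← intervalIntegral.integral_add (hint _) (hint _),
    intervalIntegral.integral_eq_sub_of_hasDerivAt (fun u _ => hderiv u) ((hint _).add (hint _)),
    mul_zero, mul_zero, expNegSum_succ_zero, Real.exp_zero]
  ring

theorem summable_parity_exp (s : ℕ) (x : ℝ) :
    Summable fun n : ℕ => x ^ (2 * n + s + 1) / ((2 * n + s + 1).factorial : ℝ) := by
  have hinj : Function.Injective fun n => 2 * n + s + 1 := fun a b h => by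
    have h' : 2 * a + s + 1 = 2 * b + s + 1 := h
    omega
  exact (Real.summable_pow_div_factorial x).comp_injective hinj

theorem tsum_parity_exp_add_succ (s : ℕ) (x : ℝ) :
    ∑' n : ℕ, x ^ (2 * n + s + 1) / ((2 * n + s + 1).factorial : ℝ) +
      ∑' n : ℕ, x ^ (2 * n + (s + 1) + 1) / ((2 * n + (s + 1) + 1).factorial : ℝ) =
      Real.exp x - expNegSum (s + 1) (-x) := by
  have hexp : ∑' k : ℕ, x ^ k / (k.factorial : ℝ) = Real.exp x := by
    rw [Real.exp_eq_exp_ℝ]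
    exact (NormedSpace.expSeries_div_hasSum_exp x).tsum_eq
  have hhead := (Real.summable_pow_div_factorial x).sum_add_tsum_nat_add (s + 1)
  have hidx : ∀ n, 2 * n + (s + 1) + 1 = 2 * n + 1 + (s + 1) := fun n => by ring
  have hodd := summable_parity_exp (s + 1) x
  simp only [hidx] at hodd ⊢
  have hparity := tsum_even_add_odd
    (f := fun k : ℕ => x ^ (k + (s + 1)) / ((k + (s + 1)).factorial : ℝ))
    (summable_parity_exp s x) hodd
  rw [expNegSum, neg_neg, ← hexp, ← hhead, add_sub_cancel_left, ← hparity]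
  rfl

-- Consecutive values of either side add up to elementary functions, so induction on `s` reduces
-- the identity to the case `s = 0`, where the series is that of `sinh`.
theorem pairProb_sub_sq (s : ℕ) (t : ℝ) :
    pairProb s t - pairProb 0 t * pairProb 0 t = -(1 / 2) * Real.exp (-2 * t) *
      ∑' n : ℕ, (-2 * t) ^ (2 * n + s + 1) / ((2 * n + s + 1).factorial : ℝ) := by
  induction s with
  | zero =>
    have hsinh := (Real.hasSum_sinh (-2 * t)).tsum_eq
    simp only [add_zero]
    rw [hsinh, Real.sinh_eq, pairProb_zero, Real.exp_neg]
    field_simp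
    ring
  | succ s ih =>
    have hpair := pairProb_add_succ s t
    have hseries := tsum_parity_exp_add_succ s (-2 * t)
    rw [neg_mul, neg_neg, ← neg_mul] at hseries
    rw [← eq_sub_iff_add_eq'] at hpair hseries
    rw [hpair, hseries, mul_sub, ← ih, pairProb_zero]
    ring

end ExponentialSums

section Expectations

variable {ι : Type*} {σ τ : ℕ → ι} {H : (ι → unitInterval) → ℝ}

theorem isBddMeasurableOn_segmentVacancy (n : ℕ) {i j : ι} {s : Set ι} (hi : i ∈ s) (hj : j ∈ s) :
    IsBddMeasurableOn (fun T : ι → unitInterval => segmentVacancy n (T i) (T j)) s :=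
  isBddMeasurableOn_comp (measurable_segmentVacancy n)
    (fun _ hw _ hv => abs_segmentVacancy_le n hw hv) hi hj

theorem isBddMeasurableOn_segmentPair (n : ℕ) {i j : ι} {s : Set ι} (hi : i ∈ s) (hj : j ∈ s) :
    IsBddMeasurableOn (fun T : ι → unitInterval => segmentPair n (T i) (T j)) s :=
  isBddMeasurableOn_comp (continuous_segmentPair n).measurable
    (fun _ hu _ hv => abs_segmentPair_le n hu hv) hi hj

theorem isBddMeasurableOn_exp_neg {i : ι} {s : Set ι} (hi : i ∈ s) :
    IsBddMeasurableOn (fun T : ι → unitInterval => Real.exp (-T i)) s :=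
  isBddMeasurableOn_comp (f := fun x _ => Real.exp (-x)) (C := 1) (by fun_prop)
    (fun x hx _ _ => by simpa using hx.1) hi hi

theorem integral_mul_sub_integral_mul_ite_lt {A G : (ι → unitInterval) → ℝ} {f : ℝ → ℝ → ℝ}
    {i j p : ι} (hi : i ≠ j) (hp : p ≠ j) (hH : IsBddMeasurableOn H {j}ᶜ)
    (hf : IsBddMeasurableOn (fun T : ι → unitInterval => f (T p) (T j)) univ)
    (hA : IsBddMeasurableOn A univ) (hG : IsBddMeasurableOn G univ)
    (hGA : ∀ T, H T ≠ 0 → G T = A T - ∫ x in (0 : ℝ)..T i, f (T p) x) :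
    ∫ T, H T * A T ∂uniformLaw ι -
        ∫ T, H T * ((if T j < T i then 1 else 0) * f (T p) (T j)) ∂uniformLaw ι =
      ∫ T, H T * G T ∂uniformLaw ι := by
  have hHuniv := hH.mono (subset_univ _)
  have hinner : ∀ T, H T * (∫ x in (0 : ℝ)..T i, f (T p) x) = H T * A T - H T * G T := by
    intro T
    by_cases hT : H T = 0
    · simp only [hT, zero_mul, sub_zero]
    · rw [hGA T hT]
      ring
  rw [integral_mul_ite_lt hi hp hH hf]
  simp only [hinner]
  rw [integral_sub ((hHuniv.mul hA).integrable _) ((hHuniv.mul hG).integrable _), sub_sub_cancel]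

theorem integral_mul_vacancyUpTo (hσ : Function.Injective σ) (n : ℕ)
    (hH : IsBddMeasurableOn H (σ '' Icc 1 n)ᶜ) :
    ∫ T, H T * vacancyUpTo (n + 1) (fun k => T (σ k)) ∂uniformLaw ι =
      ∫ T, H T * segmentVacancy n (T (σ (n + 1))) (T (σ 0)) ∂uniformLaw ι := by
  induction n generalizing σ H with
  | zero =>
    simp only [vacancyUpTo_succ, vacancyUpTo_zero, segmentVacancy_zero, zero_add,
      Subtype.coe_lt_coe]
  | succ n ih =>
    have hHuniv := hH.mono (subset_univ _)
    have hlt := isBddMeasurableOn_lt (X := unitInterval) (mem_univ (σ 1)) (mem_univ (σ 0))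
    have hvac := isBddMeasurableOn_vacancyUpTo (X := unitInterval) (n := n + 1)
      (σ := fun k => σ (k + 1)) fun _ _ => mem_univ _
    have hH' : IsBddMeasurableOn (fun T => H T * if T (σ 1) < T (σ 0) then 1 else 0)
        ((fun k => σ (k + 1)) '' Icc 1 n)ᶜ := by
      refine (hH.mono (compl_subset_compl.2 ?_)).mul (isBddMeasurableOn_lt ?_ ?_)
      · rintro _ ⟨k, hk, rfl⟩
        exact ⟨k + 1, ⟨Nat.le_add_left 1 k, Nat.succ_le_succ hk.2⟩, rfl⟩
      all_goals
        rintro ⟨k, ⟨hk, -⟩, h⟩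
        have := hσ h
        omega
    calc ∫ T, H T * vacancyUpTo (n + 2) (fun k => T (σ k)) ∂uniformLaw ι
        = ∫ T, H T * 1 ∂uniformLaw ι - ∫ T, (H T * if T (σ 1) < T (σ 0) then 1 else 0) *
            vacancyUpTo (n + 1) (fun k => T (σ (k + 1))) ∂uniformLaw ι := by
          rw [← integral_sub ((hHuniv.mul (isBddMeasurableOn_one univ)).integrable _)
            (((hHuniv.mul hlt).mul hvac).integrable _)]
          simp only [vacancyUpTo_succ (n + 1), mul_sub, mul_ite, ite_mul, mul_one, mul_zero,
            zero_mul]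
      _ = ∫ T, H T * 1 ∂uniformLaw ι - ∫ T, H T * ((if T (σ 1) < T (σ 0) then 1 else 0) *
            segmentVacancy n (T (σ (n + 2))) (T (σ 1))) ∂uniformLaw ι := by
          rw [ih (σ := fun k => σ (k + 1)) (hσ.comp (add_left_injective 1)) hH']
          simp only [mul_assoc]
      _ = ∫ T, H T * segmentVacancy (n + 1) (T (σ (n + 2))) (T (σ 0)) ∂uniformLaw ι :=
          integral_mul_sub_integral_mul_ite_lt (hσ.ne (by omega)) (hσ.ne (by omega))
            (hH.mono (by simp [hσ.mem_set_image]))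
            (isBddMeasurableOn_segmentVacancy n (mem_univ _) (mem_univ _))
            (isBddMeasurableOn_one univ)
            (isBddMeasurableOn_segmentVacancy (n + 1) (mem_univ _) (mem_univ _))
            fun T _ => segmentVacancy_succ n (T _).2.1 (T _).2.1

theorem integral_mul_vacancy (hσ : Function.Injective σ)
    (hH : IsBddMeasurableOn H (σ '' Ici 1)ᶜ) :
    ∫ T, H T * vacancy (fun k => T (σ k)) ∂uniformLaw ι =
      ∫ T, H T * Real.exp (-T (σ 0)) ∂uniformLaw ι := by
  have hHuniv := hH.mono (subset_univ _)
  obtain ⟨C, hC⟩ := hH.bounded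
  have hvac := fun n => isBddMeasurableOn_vacancyUpTo (X := unitInterval) (n := n) (σ := σ)
    fun _ _ => mem_univ _
  have hseg := fun n => isBddMeasurableOn_segmentVacancy n (mem_univ (σ (n + 1))) (mem_univ (σ 0))
  have hfinite : ∀ n, ∫ T, H T * vacancyUpTo (n + 1) (fun k => T (σ k)) ∂uniformLaw ι =
      ∫ T, H T * segmentVacancy n (T (σ (n + 1))) (T (σ 0)) ∂uniformLaw ι := fun n =>
    integral_mul_vacancyUpTo hσ n
      (hH.mono (compl_subset_compl.2 (image_mono fun _ hk => hk.1)))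
  have hleft : Tendsto (fun n => ∫ T, H T * vacancyUpTo (n + 1) (fun k => T (σ k)) ∂uniformLaw ι)
      atTop (𝓝 (∫ T, H T * vacancy (fun k => T (σ k)) ∂uniformLaw ι)) := by
    refine tendsto_integral_of_dominated_convergence (fun _ => C * 1)
      (fun n => (hHuniv.mul (hvac (n + 1))).measurable.aestronglyMeasurable)
      (integrable_const _) (fun n => .of_forall fun T => ?_) ?_
    · rw [norm_mul]
      refine mul_le_mul (hC T) ?_ (norm_nonneg _) ((abs_nonneg _).trans (hC T))
      rcases vacancyUpTo_eq_zero_or_one (n + 1) fun k => T (σ k) with h | h <;> simp [h]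
    · filter_upwards [ae_exists_not_lt hσ] with T hT
      exact ((tendsto_vacancyUpTo hT).comp (tendsto_add_atTop_nat 1)).const_mul _
  have hright : Tendsto
      (fun n => ∫ T, H T * segmentVacancy n (T (σ (n + 1))) (T (σ 0)) ∂uniformLaw ι)
      atTop (𝓝 (∫ T, H T * Real.exp (-T (σ 0)) ∂uniformLaw ι)) := by
    refine tendsto_integral_of_dominated_convergence (fun _ => C * (3 * Real.exp 1))
      (fun n => (hHuniv.mul (hseg n)).measurable.aestronglyMeasurable)
      (integrable_const _) (fun n => .of_forall fun T => ?_) (.of_forall fun T => ?_)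
    · rw [norm_mul]
      exact mul_le_mul (hC T) (abs_segmentVacancy_le n (T _).2 (T _).2) (norm_nonneg _)
        ((abs_nonneg _).trans (hC T))
    · refine (tendsto_segmentVacancy (C := 1) fun n => ?_).const_mul _
      exact abs_sub_le_of_nonneg_of_le (T _).2.1 (T _).2.2 (T _).2.1 (T _).2.2
  exact tendsto_nhds_unique hleft (hright.congr fun n => (hfinite n).symm)

theorem integral_mul_vacancy_mul_vacancy (hσ : Function.Injective σ) (hτ : Function.Injective τ)
    (hστ : ∀ k l, σ k = τ l → k = 0 ∧ l = 0)
    (hH : IsBddMeasurableOn H (σ '' Ici 1 ∪ τ '' Ici 1)ᶜ) :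
    ∫ T, H T * (vacancy (fun k => T (σ k)) * vacancy fun k => T (τ k)) ∂uniformLaw ι =
      ∫ T, H T * (Real.exp (-T (σ 0)) * Real.exp (-T (τ 0))) ∂uniformLaw ι := by
  have hτσ : IsBddMeasurableOn (fun T : ι → unitInterval => vacancy fun k => T (τ k))
      (σ '' Ici 1)ᶜ := by
    refine isBddMeasurableOn_vacancy ?_
    rintro l ⟨k, hk, h⟩
    exact absurd (hστ k l h).1 (Nat.one_le_iff_ne_zero.1 hk)
  have hexp : IsBddMeasurableOn (fun T : ι → unitInterval => Real.exp (-T (σ 0)))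
      (τ '' Ici 1)ᶜ := by
    refine isBddMeasurableOn_exp_neg ?_
    rintro ⟨l, hl, h⟩
    exact absurd (hστ 0 l h.symm).2 (Nat.one_le_iff_ne_zero.1 hl)
  rw [compl_union] at hH
  have hHσ := (hH.mono inter_subset_left).mul hτσ
  have hHτ := (hH.mono inter_subset_right).mul hexp
  calc ∫ T, H T * (vacancy (fun k => T (σ k)) * vacancy fun k => T (τ k)) ∂uniformLaw ι
      = ∫ T, (H T * vacancy fun k => T (τ k)) * vacancy (fun k => T (σ k)) ∂uniformLaw ι := by
        simp only [← mul_assoc, mul_right_comm]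
    _ = ∫ T, (H T * Real.exp (-T (σ 0))) * vacancy (fun k => T (τ k)) ∂uniformLaw ι := by
        rw [integral_mul_vacancy hσ hHσ]
        simp only [mul_right_comm]
    _ = ∫ T, H T * (Real.exp (-T (σ 0)) * Real.exp (-T (τ 0))) ∂uniformLaw ι := by
        rw [integral_mul_vacancy hτ hHτ]
        simp only [mul_assoc]

theorem integral_mul_vacancyUpTo_mul_vacancyUpTo_reverse_succ (σ : ℕ → ι) (n : ℕ)
    (hH : IsBddMeasurableOn H univ) :
    ∫ T, H T * (vacancyUpTo (n + 1) (fun k => T (σ k)) *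
        vacancyUpTo (n + 1) fun k => T (σ (n + 1 - k))) ∂uniformLaw ι =
      ∫ T, H T * vacancyUpTo (n + 1) (fun k => T (σ k)) ∂uniformLaw ι -
        ∫ T, (H T * if T (σ n) < T (σ (n + 1)) then 1 else 0) *
          (vacancyUpTo n (fun k => T (σ k)) *
            vacancyUpTo n fun k => T (σ (n - k))) ∂uniformLaw ι := by
  have hvac : ∀ m, ∀ ρ : ℕ → ι, IsBddMeasurableOn (fun T : ι → unitInterval =>
      vacancyUpTo m (fun k => T (ρ k))) univ :=
    fun m ρ => isBddMeasurableOn_vacancyUpTo fun _ _ => mem_univ _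
  have hlt := isBddMeasurableOn_lt (X := unitInterval) (mem_univ (σ n)) (mem_univ (σ (n + 1)))
  rw [← integral_sub ((hH.mul (hvac _ σ)).integrable _)
    (((hH.mul hlt).mul ((hvac n σ).mul (hvac n fun k => σ (n - k)))).integrable _)]
  refine integral_congr_ae (.of_forall fun T => ?_)
  simp only [vacancyUpTo_mul_vacancyUpTo_reverse_succ n fun k => T (σ k), mul_sub, mul_assoc]

theorem integral_mul_vacancyUpTo_mul_vacancyUpTo_reverse (hσ : Function.Injective σ) (n : ℕ)
    (hH : IsBddMeasurableOn H (σ '' Icc 1 n)ᶜ) (hlt : ∀ T, H T ≠ 0 → T (σ (n + 1)) < T (σ 0)) :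
    ∫ T, H T * (vacancyUpTo (n + 1) (fun k => T (σ k)) *
        vacancyUpTo (n + 1) fun k => T (σ (n + 1 - k))) ∂uniformLaw ι =
      ∫ T, H T * segmentPair n (T (σ 0)) (T (σ (n + 1))) ∂uniformLaw ι := by
  induction n generalizing H with
  | zero =>
    refine integral_congr_ae (.of_forall fun T => ?_)
    by_cases hT : H T = 0
    · simp only [hT, zero_mul]
    · simp [vacancyUpTo_succ, vacancyUpTo_zero, segmentPair_zero, hlt T hT]
  | succ n ih =>
    have hH' : IsBddMeasurableOn (fun T => H T * if T (σ (n + 1)) < T (σ (n + 2)) then 1 else 0)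
        (σ '' Icc 1 n)ᶜ := by
      refine (hH.mono (compl_subset_compl.2 (image_mono (Icc_subset_Icc_right n.le_succ)))).mul
        (isBddMeasurableOn_lt ?_ ?_) <;> simp [hσ.mem_set_image]
    have hlt' : ∀ T, (H T * if T (σ (n + 1)) < T (σ (n + 2)) then 1 else 0) ≠ 0 →
        T (σ (n + 1)) < T (σ 0) := by
      intro T hT
      rw [mul_ite, mul_one, mul_zero, ite_ne_right_iff] at hT
      exact hT.1.trans (hlt T hT.2)
    calc ∫ T, H T * (vacancyUpTo (n + 2) (fun k => T (σ k)) *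
          vacancyUpTo (n + 2) fun k => T (σ (n + 2 - k))) ∂uniformLaw ι
        = ∫ T, H T * vacancyUpTo (n + 2) (fun k => T (σ k)) ∂uniformLaw ι -
            ∫ T, (H T * if T (σ (n + 1)) < T (σ (n + 2)) then 1 else 0) *
              (vacancyUpTo (n + 1) (fun k => T (σ k)) *
                vacancyUpTo (n + 1) fun k => T (σ (n + 1 - k))) ∂uniformLaw ι :=
          integral_mul_vacancyUpTo_mul_vacancyUpTo_reverse_succ σ (n + 1) (hH.mono (subset_univ _))
      _ = ∫ T, H T * segmentVacancy (n + 1) (T (σ (n + 2))) (T (σ 0)) ∂uniformLaw ι -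
            ∫ T, H T * ((if T (σ (n + 1)) < T (σ (n + 2)) then 1 else 0) *
              segmentPair n (T (σ 0)) (T (σ (n + 1)))) ∂uniformLaw ι := by
          rw [integral_mul_vacancyUpTo hσ (n + 1) hH, ih hH' hlt']
          simp only [mul_assoc]
      _ = ∫ T, H T * segmentPair (n + 1) (T (σ 0)) (T (σ (n + 2))) ∂uniformLaw ι :=
          integral_mul_sub_integral_mul_ite_lt (hσ.ne (by omega)) (hσ.ne (by omega))
            (hH.mono (by simp [hσ.mem_set_image]))
            (isBddMeasurableOn_segmentPair n (mem_univ _) (mem_univ _))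
            (isBddMeasurableOn_segmentVacancy (n + 1) (mem_univ _) (mem_univ _))
            (isBddMeasurableOn_segmentPair (n + 1) (mem_univ _) (mem_univ _))
            fun T hT => segmentPair_succ n (hlt T hT)

theorem integral_ite_le_mul_ite_lt_mul_segmentPair {i j : ι} (hij : i ≠ j) (n : ℕ)
    (t : unitInterval) :
    ∫ T, (if T i ≤ t then 1 else 0) * (if T j < T i then 1 else 0) *
        segmentPair n (T i) (T j) * (Real.exp (-T i) * Real.exp (-T j)) ∂uniformLaw ι =
      1 / 2 * pairProb (n + 1) t := by
  have hH : IsBddMeasurableOn (fun T : ι → unitInterval =>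
      (if T i ≤ t then 1 else 0) * Real.exp (-T i)) {j}ᶜ :=
    ((isBddMeasurableOn_le i t).mono (singleton_subset_iff.2 hij)).mul
      (isBddMeasurableOn_exp_neg hij)
  have hf : IsBddMeasurableOn (fun T : ι → unitInterval =>
      Real.exp (-T j) * segmentPair n (T i) (T j)) univ :=
    (isBddMeasurableOn_exp_neg (mem_univ j)).mul
      (isBddMeasurableOn_segmentPair n (mem_univ i) (mem_univ j))
  have hmeas : Measurable fun u : ℝ =>
      1 / 2 * (Real.exp (-2 * u) * (1 - expNegSum (n + 1) (2 * u))) := by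
    have := continuous_expNegSum (n + 1)
    fun_prop
  calc ∫ T, (if T i ≤ t then 1 else 0) * (if T j < T i then 1 else 0) *
        segmentPair n (T i) (T j) * (Real.exp (-T i) * Real.exp (-T j)) ∂uniformLaw ι
      = ∫ T, (if T i ≤ t then 1 else 0) * Real.exp (-T i) * ((if T j < T i then 1 else 0) *
          (Real.exp (-T j) * segmentPair n (T i) (T j))) ∂uniformLaw ι := by
        refine integral_congr_ae (.of_forall fun T => ?_)
        ring
    _ = ∫ T, (if T i ≤ t then 1 / 2 * (Real.exp (-2 * T i) *
          (1 - expNegSum (n + 1) (2 * T i))) else 0) ∂uniformLaw ι := by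
        rw [integral_mul_ite_lt (f := fun u v => Real.exp (-v) * segmentPair n u v) hij hij hH hf]
        refine integral_congr_ae (.of_forall fun T => ?_)
        have hexp : Real.exp (-2 * (T i : ℝ)) = Real.exp (-T i) * Real.exp (-T i) := by
          rw [← Real.exp_add]
          ring_nf
        simp only [integral_exp_neg_mul_segmentPair, hexp, ite_mul, one_mul, zero_mul]
        ring_nf
    _ = 1 / 2 * pairProb (n + 1) t := by
        rw [integral_ite_le_uniformLaw i t hmeas, intervalIntegral.integral_const_mul, pairProb]

end Expectations

section Lattice

theorem injective_add_units_mul_natCast (ε : ℤˣ) (s : ℤ) :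
    Function.Injective fun k : ℕ => s + (ε : ℤ) * k :=
  (add_right_injective s).comp ((mul_right_injective₀ ε.ne_zero).comp Nat.cast_injective)

theorem ae_generic : ∀ᵐ T ∂timesLaw, Generic T := by
  refine ae_all_iff.2 fun ε => ae_all_iff.2 fun s => (ae_infinitePi_apply_ne volume ?_).and
    (ae_exists_not_lt (injective_add_units_mul_natCast ε s))
  simp

theorem isBddMeasurableOn_evolution (s : ℤ) (t : unitInterval) :
    IsBddMeasurableOn (fun T => evolution T s t) univ :=
  (((isBddMeasurableOn_le s t).mono (subset_univ _)).mul
    (isBddMeasurableOn_vacancy fun _ => mem_univ _)).mul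
    (isBddMeasurableOn_vacancy fun _ => mem_univ _)

theorem state_ae_eq_evolution (s : ℤ) (t : unitInterval) :
    state s t =ᵐ[timesLaw] fun T => evolution T s t :=
  ae_generic.mono fun _ hT => hT.state_eq s t

theorem aemeasurable_state (s : ℤ) (t : unitInterval) : AEMeasurable (state s t) timesLaw :=
  ⟨_, (isBddMeasurableOn_evolution s t).measurable, state_ae_eq_evolution s t⟩

theorem integral_evolution (s : ℤ) (t : unitInterval) :
    ∫ T, evolution T s t ∂timesLaw = pairProb 0 t := by
  have hdisj : ∀ k l : ℕ, s + (-1 : ℤˣ) * k = s + (1 : ℤˣ) * l → k = 0 ∧ l = 0 := by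
    intro k l h
    rw [Units.val_neg, Units.val_one] at h
    omega
  have hH : IsBddMeasurableOn (fun T : ℤ → unitInterval => if T s ≤ t then 1 else 0)
      ((fun k : ℕ => s + (-1 : ℤˣ) * k) '' Ici 1 ∪ (fun k : ℕ => s + (1 : ℤˣ) * k) '' Ici 1)ᶜ :=
    (isBddMeasurableOn_le s t).mono (by simp)
  have h := integral_mul_vacancy_mul_vacancy (injective_add_units_mul_natCast (-1) s)
    (injective_add_units_mul_natCast 1 s) hdisj hH
  calc ∫ T, evolution T s t ∂timesLaw
      = ∫ T, (if T s ≤ t then Real.exp (-2 * T s) else 0) ∂timesLaw := by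
        simp only [evolution, mul_assoc]
        refine h.trans (integral_congr_ae (.of_forall fun T => ?_))
        simp only [Nat.cast_zero, mul_zero, add_zero, ite_mul, one_mul, zero_mul, ← Real.exp_add]
        ring_nf
    _ = pairProb 0 t := by
        rw [pairProb]
        simp only [expNegSum_zero, sub_zero, mul_one]
        exact integral_ite_le_uniformLaw s t (f := fun u => Real.exp (-2 * u)) (by fun_prop)

theorem Generic.vacancy_ray_mul_vacancy_ray_add {T : ℤ → unitInterval} (hT : Generic T) (ε : ℤˣ)
    (s : ℤ) (n : ℕ) :
    vacancy (ray ε s T) * vacancy (ray ε (s + ε * n) T) =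
      vacancyUpTo n (ray ε s T) * vacancy (ray ε (s + ε * n) T) := by
  have hray : (fun k => ray ε s T (k + n)) = ray ε (s + ε * n) T := funext fun k => ray_add ..
  rw [← hray]
  refine vacancy_mul_vacancy_add ?_
  simpa only [ray_add ε s T _ n] using (hT ε (s + ε * n)).2

theorem Generic.evolution_mul_evolution {T : ℤ → unitInterval} (hT : Generic T) (ε : ℤˣ)
    {i j : ℤ} {n : ℕ} (hj : i + ε * n = j) (hlt : T j < T i) (t : unitInterval) :
    evolution T i t * evolution T j t =
      (if T i ≤ t then 1 else 0) * (vacancy (ray (-ε) i T) * vacancy (ray ε j T)) *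
        (vacancyUpTo n (ray ε i T) * vacancyUpTo n fun k => ray ε i T (n - k)) := by
  have hforward := hT.vacancy_ray_mul_vacancy_ray_add ε i n
  have hi : j + (-ε : ℤˣ) * n = i := by
    rw [← hj, Units.val_neg]
    ring
  have hbackward := hT.vacancy_ray_mul_vacancy_ray_add (-ε) j n
  have hrev : vacancyUpTo n (ray (-ε) j T) = vacancyUpTo n fun k => ray ε i T (n - k) := by
    refine vacancyUpTo_congr fun k hk => ?_
    rw [ray, ray, ← hj, Units.val_neg]
    push_cast [hk]
    ring_nf
  rw [hj] at hforward
  rw [hi, hrev] at hbackward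
  rw [evolution_eq ε T i, evolution_eq ε T j]
  by_cases hle : T i ≤ t
  · rw [if_pos hle, if_pos (hlt.le.trans hle)]
    linear_combination vacancy (ray (-ε) j T) * vacancy (ray (-ε) i T) * hforward +
      vacancyUpTo n (ray ε i T) * vacancy (ray ε j T) * hbackward
  · simp only [if_neg hle, zero_mul]

theorem isBddMeasurableOn_ite_le_mul_ite_lt {i j : ℤ} (t : unitInterval) {s : Set ℤ}
    (hi : i ∈ s) (hj : j ∈ s) :
    IsBddMeasurableOn (fun T : ℤ → unitInterval =>
      (if T i ≤ t then 1 else 0) * (if T j < T i then 1 else 0)) s :=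
  ((isBddMeasurableOn_le i t).mono (singleton_subset_iff.2 hi)).mul (isBddMeasurableOn_lt hj hi)

section OrderedPair

variable (ε : ℤˣ) {i j : ℤ} {n : ℕ} (hj : i + ε * (n + 1 : ℕ) = j) (t : unitInterval)
include hj

theorem integral_mul_vacancyUpTo_ray_mul_vacancyUpTo_ray :
    ∫ T, (if T i ≤ t then 1 else 0) * (if T j < T i then 1 else 0) *
        (vacancy (ray (-ε) i T) * vacancy (ray ε j T)) *
        (vacancyUpTo (n + 1) (ray ε i T) *
          vacancyUpTo (n + 1) fun k => ray ε i T (n + 1 - k)) ∂timesLaw =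
      ∫ T, (if T i ≤ t then 1 else 0) * (if T j < T i then 1 else 0) *
        (vacancy (ray (-ε) i T) * vacancy (ray ε j T)) * segmentPair n (T i) (T j) ∂timesLaw := by
  have hH : IsBddMeasurableOn (fun T : ℤ → unitInterval =>
      (if T i ≤ t then 1 else 0) * (if T j < T i then 1 else 0) *
        (vacancy (ray (-ε) i T) * vacancy (ray ε j T)))
      ((fun k : ℕ => i + (ε : ℤ) * k) '' Icc 1 n)ᶜ := by
    have hleft : ∀ l : ℕ, i + (-ε : ℤˣ) * l ∉ (fun k : ℕ => i + (ε : ℤ) * k) '' Icc 1 n := by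
      rintro l ⟨k, ⟨hk, -⟩, h⟩
      rcases Int.units_eq_one_or ε with rfl | rfl <;>
        simp only [Units.val_neg, Units.val_one, neg_neg, one_mul, neg_mul] at h hj <;> omega
    have hright : ∀ l : ℕ, j + ε * l ∉ (fun k : ℕ => i + (ε : ℤ) * k) '' Icc 1 n := by
      rintro l ⟨k, ⟨-, hk⟩, h⟩
      rcases Int.units_eq_one_or ε with rfl | rfl <;>
        simp only [Units.val_neg, Units.val_one, one_mul, neg_mul] at h hj <;> omega
    exact (isBddMeasurableOn_ite_le_mul_ite_lt t (by simp)
      (by simpa using hright 0)).mul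
      ((isBddMeasurableOn_vacancy hleft).mul (isBddMeasurableOn_vacancy hright))
  have h := integral_mul_vacancyUpTo_mul_vacancyUpTo_reverse
    (injective_add_units_mul_natCast ε i) n hH fun T hT => by
      simp only [hj, Nat.cast_zero, mul_zero, add_zero]
      by_contra hlt
      simp [hlt] at hT
  simp only [Nat.cast_zero, mul_zero, add_zero, hj] at h
  exact h

theorem integral_mul_vacancy_ray_mul_vacancy_ray :
    ∫ T, (if T i ≤ t then 1 else 0) * (if T j < T i then 1 else 0) * segmentPair n (T i) (T j) *
        (vacancy (ray (-ε) i T) * vacancy (ray ε j T)) ∂timesLaw =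
      ∫ T, (if T i ≤ t then 1 else 0) * (if T j < T i then 1 else 0) * segmentPair n (T i) (T j) *
        (Real.exp (-T i) * Real.exp (-T j)) ∂timesLaw := by
  have hdisj : ∀ k l : ℕ, i + (-ε : ℤˣ) * k = j + ε * l → k = 0 ∧ l = 0 := by
    intro k l h
    rcases Int.units_eq_one_or ε with rfl | rfl <;>
      simp only [Units.val_neg, Units.val_one, neg_neg, one_mul, neg_mul] at h hj <;> omega
  have hH : IsBddMeasurableOn (fun T : ℤ → unitInterval =>
      (if T i ≤ t then 1 else 0) * (if T j < T i then 1 else 0) * segmentPair n (T i) (T j))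
      ((fun k : ℕ => i + (-ε : ℤˣ) * k) '' Ici 1 ∪ (fun k : ℕ => j + (ε : ℤ) * k) '' Ici 1)ᶜ := by
    refine (isBddMeasurableOn_ite_le_mul_ite_lt t ?_ ?_).mul
      (isBddMeasurableOn_segmentPair n ?_ ?_)
    all_goals
      simp only [mem_compl_iff, mem_union, mem_image, mem_Ici, not_or, not_exists, not_and]
      refine ⟨fun k hk h => ?_, fun k hk h => ?_⟩ <;>
        rcases Int.units_eq_one_or ε with rfl | rfl <;>
          simp only [Units.val_neg, Units.val_one, neg_neg, one_mul, neg_mul] at h hj <;> omega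
  have h := integral_mul_vacancy_mul_vacancy (injective_add_units_mul_natCast (-ε) i)
    (injective_add_units_mul_natCast ε j) hdisj hH
  simp only [Nat.cast_zero, mul_zero, add_zero] at h
  exact h

theorem integral_ite_lt_mul_evolution_mul_evolution :
    ∫ T, (if T j < T i then 1 else 0) * (evolution T i t * evolution T j t) ∂timesLaw =
      1 / 2 * pairProb (n + 1) t := by
  have hij : i ≠ j := by
    rcases Int.units_eq_one_or ε with rfl | rfl <;>
      simp only [Units.val_neg, Units.val_one, one_mul, neg_mul] at hj <;> omega
  calc ∫ T, (if T j < T i then 1 else 0) * (evolution T i t * evolution T j t) ∂timesLaw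
      = ∫ T, (if T i ≤ t then 1 else 0) * (if T j < T i then 1 else 0) *
          (vacancy (ray (-ε) i T) * vacancy (ray ε j T)) *
          (vacancyUpTo (n + 1) (ray ε i T) *
            vacancyUpTo (n + 1) fun k => ray ε i T (n + 1 - k)) ∂timesLaw := by
        refine integral_congr_ae (ae_generic.mono fun T hT => ?_)
        by_cases hlt : T j < T i
        · simp only [if_pos hlt, one_mul, mul_one, hT.evolution_mul_evolution ε hj hlt]
        · simp only [if_neg hlt, zero_mul, mul_zero]
    _ = ∫ T, (if T i ≤ t then 1 else 0) * (if T j < T i then 1 else 0) *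
          segmentPair n (T i) (T j) *
          (vacancy (ray (-ε) i T) * vacancy (ray ε j T)) ∂timesLaw := by
        rw [integral_mul_vacancyUpTo_ray_mul_vacancyUpTo_ray ε hj t]
        simp only [mul_right_comm]
    _ = 1 / 2 * pairProb (n + 1) t := by
        rw [integral_mul_vacancy_ray_mul_vacancy_ray ε hj t]
        exact integral_ite_le_mul_ite_lt_mul_segmentPair hij n t

end OrderedPair

theorem integral_state (s : ℤ) (t : unitInterval) :
    ∫ T, state s t T ∂timesLaw = pairProb 0 t :=
  (integral_congr_ae (state_ae_eq_evolution s t)).trans (integral_evolution s t)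

theorem evolution_eq_zero_or_one (T : ℤ → unitInterval) (s : ℤ) (t : unitInterval) :
    evolution T s t = 0 ∨ evolution T s t = 1 := by
  rw [evolution]
  rcases vacancy_eq_zero_or_one (ray (-1) s T) with h | h <;>
    rcases vacancy_eq_zero_or_one (ray 1 s T) with h' | h' <;> split_ifs <;> simp [h, h']

theorem integral_evolution_mul_evolution {i j : ℤ} (hij : i ≠ j) (t : unitInterval) :
    ∫ T, evolution T i t * evolution T j t ∂timesLaw = pairProb (j - i).natAbs t := by
  obtain ⟨n, hn⟩ : ∃ n, (j - i).natAbs = n + 1 :=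
    Nat.exists_eq_succ_of_ne_zero (Int.natAbs_ne_zero.2 (sub_ne_zero.2 hij.symm))
  obtain ⟨ε, hj, hi⟩ : ∃ ε : ℤˣ, i + ε * (n + 1 : ℕ) = j ∧ j + (-ε : ℤˣ) * (n + 1 : ℕ) = i := by
    rcases Int.natAbs_eq (j - i) with h | h
    · exact ⟨1, by rw [Units.val_one]; omega, by rw [Units.val_neg, Units.val_one]; omega⟩
    · exact ⟨-1, by rw [Units.val_neg, Units.val_one]; omega,
        by rw [neg_neg, Units.val_one]; omega⟩
  have hprod := (isBddMeasurableOn_evolution i t).mul (isBddMeasurableOn_evolution j t)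
  have hint : ∀ k l : ℤ, Integrable (fun T : ℤ → unitInterval =>
      (if T l < T k then 1 else 0) * (evolution T i t * evolution T j t)) timesLaw := fun k l =>
    ((isBddMeasurableOn_lt (mem_univ l) (mem_univ k)).mul hprod).integrable (uniformLaw ℤ)
  calc ∫ T, evolution T i t * evolution T j t ∂timesLaw
      = ∫ T, ((if T j < T i then 1 else 0) * (evolution T i t * evolution T j t) +
          (if T i < T j then 1 else 0) * (evolution T i t * evolution T j t)) ∂timesLaw := by
        refine integral_congr_ae ((ae_infinitePi_apply_ne volume hij).mono fun T hT => ?_)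
        rcases lt_or_gt_of_ne hT with h | h <;> simp [h, h.not_gt]
    _ = 1 / 2 * pairProb (n + 1) t + 1 / 2 * pairProb (n + 1) t := by
        rw [integral_add (hint i j) (hint j i),
          integral_ite_lt_mul_evolution_mul_evolution ε hj]
        simp only [mul_comm (evolution _ i t)]
        rw [integral_ite_lt_mul_evolution_mul_evolution (-ε) hi]
    _ = pairProb (j - i).natAbs t := by
        rw [hn]
        ring

theorem integral_state_mul_state (i j : ℤ) (t : unitInterval) :
    ∫ T, state i t T * state j t T ∂timesLaw = pairProb (j - i).natAbs t := by
  refine (integral_congr_ae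
    ((state_ae_eq_evolution i t).mul (state_ae_eq_evolution j t))).trans ?_
  rcases eq_or_ne i j with rfl | hij
  · have hsq : ∀ T, evolution T i t * evolution T i t = evolution T i t := fun T => by
      rcases evolution_eq_zero_or_one T i t with h | h <;> simp [h]
    simp only [Pi.mul_apply, hsq, sub_self, Int.natAbs_zero, integral_evolution]
  · exact integral_evolution_mul_evolution hij t

end Lattice

end RSA

/-- Almost every family of arrival times determines a unique evolution, the states are random
variables, and the pair correlation is given by the stated convergent series. -/
theorem theorem2 :
    (∀ᵐ T ∂(RSA.timesLaw), ∃! η : ℤ → unitInterval → ℝ, RSA.IsEvolution T η) ∧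
    (∀ (s : ℤ) (t : unitInterval), AEMeasurable (RSA.state s t) RSA.timesLaw) ∧
    ∀ (t : unitInterval) (s : ℤ),
      Summable (fun n : ℕ => (-2 * (t : ℝ)) ^ (2 * n + s.natAbs + 1) /
        ((2 * n + s.natAbs + 1).factorial : ℝ)) ∧
      RSA.pairCorrelation s t =
        -(1 / 2) * Real.exp (-2 * (t : ℝ)) *
          ∑' n : ℕ, (-2 * (t : ℝ)) ^ (2 * n + s.natAbs + 1) /
            ((2 * n + s.natAbs + 1).factorial : ℝ) := by
  refine ⟨RSA.ae_generic.mono fun _ hT => hT.existsUnique_isEvolution, RSA.aemeasurable_state,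
    fun t s => ⟨RSA.summable_parity_exp _ _, ?_⟩⟩
  rw [RSA.pairCorrelation, RSA.covAt, RSA.integral_state_mul_state, sub_zero, RSA.integral_state,
    RSA.integral_state, RSA.pairProb_sub_sq]
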